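/- Let $\Bbbk$ be a field of characteristic zero and $\Omega$ a set. An algebra (of type $\Omega$) is a linear space over $\Bbbk$ with bilinear operations $\circ_\omega$, $\omega\in\Omega$; a dialgebra is a linear space with bilinear operations $\vdash_\omega,\dashv_\omega$, $\omega\in\Omega$. For a variety $\mathfrak M$ of algebras (or dialgebras), i.e. the class of all those satisfying a given set of identities, let $\mathfrak M(n)$ be the space of multilinear polynomials of degree $n$ in $x_1,\dots,x_n$ in the free algebra $\mathfrak M\langle x_1,x_2,\dots\rangle$, and let $c_n(\mathfrak M)=\dim\mathfrak M(n)$ be the $n$th codimension (a cardinal, finite if $\Omega$ is finite). Let $\mathrm{di}\text{-}\mathrm{Alg}_0$ be the variety of dialgebras defined by the identities \[ (x\vdash_\omega y-x\dashv_\omega y)\vdash_\mu z=0,\qquad x\dashv_\mu(y\vdash_\omega z-y\dashv_\omega z)=0,\qquad \omega,\mu\in\Omega . \] For a pre-commutative (Zinbiel) algebra $Z$, i.e. a linear space with a bilinear product such that $(xy+yx)z=x(yz)$, and a dialgebra $D$, let $Z\boxtimes D$ be the space $Z\otimes D$ with the operations \[ (z\otimes a)\circ_\omega(w\otimes b)=zw\otimes(a\vdash_\omega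 b)+wz\otimes(a\dashv_\omega b). \] For a variety $\mathfrak V$ of dialgebras, let its enveloping variety $\widehat{\mathfrak V}$ be the variety of algebras generated by all $Z\boxtimes D$ with $Z$ pre-commutative and $D\in\mathfrak V$. A sequence $(c_n)_{n\ge1}$ of cardinals has polynomial growth if all $c_n$ are finite and there are constants $C,d$ with $c_n\le Cn^d$ for all $n\ge1$; it has subexponential growth if all $c_n$ are finite and for every real $a>1$ there is a constant $C$ with $c_n\le Ca^n$ for all $n\ge 1$; it has intermediate growth if it has subexponential but not polynomial growth. **Theorem.** Let $\mathfrak V\subseteq\mathrm{di}\text{-}\mathrm{Alg}_0$ be a variety of dialgebras. Then for all $n\ge1$ \[ c_n(\mathfrak V)\le n\,c_n(\widehat{\mathfrak V})\qquad\text{and}\qquad c_n(\widehat{\mathfrak V})\le n\,c_n(\mathfrak V). \] In particular, the sequence $c_n(\mathfrak V)$ has polynomial (respectively intermediate) growth if and only if $c_n(\widehat{\mathfrak V})$ does. -/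

import Mathlib

universe u v w

open scoped TensorProduct

/-- A (non-associative) algebra over `k`: a linear space with a family of bilinear operations
indexed by `Ω`. -/
structure OmegaAlg (k : Type u) [Field k] (Ω : Type v) where
  carrier : Type w
  [addCommGroup : AddCommGroup carrier]
  [module : Module k carrier]
  op : Ω → carrier →ₗ[k] carrier →ₗ[k] carrier

attribute [instance] OmegaAlg.addCommGroup OmegaAlg.module

/-- Non-associative words in the variables `x₀, x₁, …` with operation symbols from `Ω`. -/
inductive OmegaWord (Ω : Type v) : Type v
  | var : ℕ → OmegaWord Ω
  | op : Ω → OmegaWord Ω → OmegaWord Ω → OmegaWord Ω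

/-- The multiset of variables occurring in a word. -/
def OmegaWord.vars {Ω : Type v} : OmegaWord Ω → Multiset ℕ
  | .var i => {i}
  | .op _ s t => s.vars + t.vars

/-- The underlying space of the free algebra `Alg⟨x₀, x₁, …⟩`: non-associative polynomials. -/
abbrev OmegaPoly (k : Type u) [Field k] (Ω : Type v) : Type (max u v) :=
  OmegaWord Ω →₀ k

/-- `Alg(n)`: the multilinear polynomials of degree `n` in `x₀, …, x_{n-1}`. -/
def multilinearPoly (k : Type u) [Field k] (Ω : Type v) (n : ℕ) :
    Submodule k (OmegaPoly k Ω) :=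
  Finsupp.supported k k {t : OmegaWord Ω | t.vars = Multiset.range n}

namespace OmegaAlg

variable {k : Type u} [Field k] {Ω : Type v}

/-- The value of a word under the substitution `xᵢ ↦ a i`. -/
def evalWord (A : OmegaAlg.{u, v, w} k Ω) (a : ℕ → A.carrier) : OmegaWord Ω → A.carrier
  | .var i => a i
  | .op ω s t => A.op ω (A.evalWord a s) (A.evalWord a t)

/-- The value of a polynomial under the substitution `xᵢ ↦ a i`. -/
noncomputable def eval (A : OmegaAlg.{u, v, w} k Ω) (a : ℕ → A.carrier) :
    OmegaPoly k Ω →ₗ[k] A.carrier :=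
  Finsupp.linearCombination k (A.evalWord a)

/-- `f = 0` is an identity on `A`. -/
def Satisfies (A : OmegaAlg.{u, v, w} k Ω) (f : OmegaPoly k Ω) : Prop :=
  ∀ a : ℕ → A.carrier, A.eval a f = 0

end OmegaAlg

section Varieties

variable {k : Type u} [Field k] {Ω : Type v}

/-- A variety is the class of all algebras satisfying some set of identities. -/
def IsVariety (V : Set (OmegaAlg.{u, v, w} k Ω)) : Prop :=
  ∃ S : Set (OmegaPoly k Ω), V = {A | ∀ f ∈ S, A.Satisfies f}

/-- The ideal of identities of a class of algebras. -/
def identities (V : Set (OmegaAlg.{u, v, w} k Ω)) : Submodule k (OmegaPoly k Ω) where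
  carrier := {f | ∀ A ∈ V, A.Satisfies f}
  add_mem' := fun hf hg A hA a => by rw [map_add, hf A hA a, hg A hA a, add_zero]
  zero_mem' := fun A _ a => map_zero (A.eval a)
  smul_mem' := fun c f hf A hA a => by rw [map_smul, hf A hA a, smul_zero]

/-- `Var(C)`: the variety generated by a class `C` of algebras. -/
def generatedVariety (C : Set (OmegaAlg.{u, v, w} k Ω)) : Set (OmegaAlg.{u, v, w} k Ω) :=
  {A | ∀ f ∈ identities C, A.Satisfies f}

/-- The underlying space of the free algebra `V⟨x₀, x₁, …⟩` of a variety `V`. -/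
abbrev RelFree (V : Set (OmegaAlg.{u, v, w} k Ω)) : Type (max u v) :=
  OmegaPoly k Ω ⧸ identities V

/-- `V(n)`: the space of multilinear polynomials of degree `n` in `x₀, …, x_{n-1}`
in the free algebra of `V`. -/
noncomputable def multilinearPart (V : Set (OmegaAlg.{u, v, w} k Ω)) (n : ℕ) : Submodule k (RelFree V) :=
  (multilinearPoly k Ω n).map (identities V).mkQ

/-- The `n`th codimension `c_n(V) = dim V(n)`. It is finite when `Ω` is finite; for an infinite
family of operations it may be an infinite cardinal. -/
noncomputable def codim (V : Set (OmegaAlg.{u, v, w} k Ω)) (n : ℕ) : Cardinal.{max u v} :=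
  Module.rank k (multilinearPart V n)

end Varieties

/-- The doubled family of operation symbols `⊢_ω`, `⊣_ω`, `ω ∈ Ω`. -/
inductive DiOp (Ω : Type v) : Type v
  | vdash : Ω → DiOp Ω
  | dashv : Ω → DiOp Ω

/-- The class `di-Alg₀` of dialgebras satisfying the identities
`(x ⊢_ω y - x ⊣_ω y) ⊢_μ z = 0` and `x ⊣_μ (y ⊢_ω z - y ⊣_ω z) = 0`. -/
def diAlgZero (k : Type u) [Field k] (Ω : Type v) : Set (OmegaAlg.{u, v, w} k (DiOp Ω)) :=
  {D | ∀ (ω μ : Ω) (x y z : D.carrier),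
    D.op (.vdash μ) (D.op (.vdash ω) x y - D.op (.dashv ω) x y) z = 0 ∧
    D.op (.dashv μ) x (D.op (.vdash ω) y z - D.op (.dashv ω) y z) = 0}

/-- A pre-commutative (Zinbiel) algebra: a linear space with a bilinear product satisfying
`(x y + y x) z = x (y z)`. -/
structure PreComAlg (k : Type u) [Field k] where
  carrier : Type w
  [addCommGroup : AddCommGroup carrier]
  [module : Module k carrier]
  mul : carrier →ₗ[k] carrier →ₗ[k] carrier
  preCom : ∀ x y z : carrier, mul (mul x y + mul y x) z = mul x (mul y z)

attribute [instance] PreComAlg.addCommGroup PreComAlg.module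

/-- The algebra `Z ⊠ D`: the space `Z ⊗ D` with the operations
`(z ⊗ a) ∘_ω (w ⊗ b) = z w ⊗ (a ⊢_ω b) + w z ⊗ (a ⊣_ω b)`. -/
noncomputable def boxtimes {k : Type u} [Field k] {Ω : Type v} (Z : PreComAlg.{u, w} k)
    (D : OmegaAlg.{u, v, w} k (DiOp Ω)) : OmegaAlg.{u, v, w} k Ω where
  carrier := Z.carrier ⊗[k] D.carrier
  op ω := TensorProduct.map₂ Z.mul (D.op (.vdash ω)) +
    TensorProduct.map₂ Z.mul.flip (D.op (.dashv ω))

/-- The enveloping variety of a variety `V` of dialgebras: the variety generated by all algebras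
`Z ⊠ D` with `Z` pre-commutative and `D ∈ V`. -/
def envelopingVariety {k : Type u} [Field k] {Ω : Type v}
    (V : Set (OmegaAlg.{u, v, w} k (DiOp Ω))) : Set (OmegaAlg.{u, v, w} k Ω) :=
  generatedVariety {B | ∃ (Z : PreComAlg.{u, w} k), ∃ D ∈ V, B = boxtimes Z D}

/-- Polynomial growth: all terms are finite and `c n ≤ C n ^ d` for some constants `C`, `d`. -/
def PolynomialGrowth (c : ℕ → Cardinal.{w}) : Prop :=
  ∃ (C : ℝ) (d : ℕ), ∀ n : ℕ, 1 ≤ n →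
    c n < Cardinal.aleph0 ∧ ((c n).toNat : ℝ) ≤ C * (n : ℝ) ^ d

/-- Subexponential growth: all terms are finite and, for every `a > 1`, `c n ≤ C a ^ n` for some
constant `C`. -/
def SubexponentialGrowth (c : ℕ → Cardinal.{w}) : Prop :=
  ∀ a : ℝ, 1 < a → ∃ C : ℝ, ∀ n : ℕ, 1 ≤ n →
    c n < Cardinal.aleph0 ∧ ((c n).toNat : ℝ) ≤ C * a ^ n

/-- Intermediate growth: subexponential but not polynomial. -/
def IntermediateGrowth (c : ℕ → Cardinal.{w}) : Prop :=
  SubexponentialGrowth c ∧ ¬ PolynomialGrowth c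

/-!
Orient a multilinear word at one of its variables `xᵢ` by letting every operation point at `xᵢ`.
In a dialgebra of `di-Alg₀` the operations `⊢_ω` and `⊣_ω` coincide modulo the elements that
annihilate everything in the non-central argument, so a multilinear dialgebra word is determined by
its center and by the word obtained by identifying `⊢_ω` with `⊣_ω`. Hence `V(n)` is the sum over
`i < n` of the images of the maps `f ↦ fᵢ` orienting multilinear polynomials at `xᵢ`.

The value of `f` at pure tensors `zᵢ ⊗ aᵢ` of `Z ⊠ D` is `∑ᵢ tᵢ ⊗ fᵢ(a)`, where `tᵢ` is the product
`z_{j₁} (z_{j₂} (⋯ zᵢ))` over all the other variables. Hence `f` is an identity of the enveloping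
variety as soon as all `fᵢ` are identities of `V`. For the converse take for `Z` the polynomials
without constant term in variables of square zero, with the product split according to the factor
that contains the largest variable: there `tᵢ` vanishes unless `zᵢ` is the largest variable, which
isolates `fᵢ`. So `c_n` of the enveloping variety is the rank of `f ↦ (fᵢ)ᵢ`, to be compared with
the dimension of the sum of the images of its `n` components.
-/

section LinearAlgebra

variable {k : Type*} [Field k] {ι κ : Type*}

section Rank

variable {U : Type*} {M N : Type w} [AddCommGroup U] [Module k U] [AddCommGroup M] [Module k M]
  [AddCommGroup N] [Module k N]

theorem rank_range_le_of_ker_le {f : U →ₗ[k] M} {g : U →ₗ[k] N}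
    (h : LinearMap.ker f ≤ LinearMap.ker g) :
    Module.rank k (LinearMap.range g) ≤ Module.rank k (LinearMap.range f) :=
  (g.quotKerEquivRange.toLinearMap ∘ₗ Submodule.factor h ∘ₗ
    f.quotKerEquivRange.symm.toLinearMap).rank_le_of_surjective <|
      g.quotKerEquivRange.surjective.comp <|
        (Submodule.factor_surjective h).comp f.quotKerEquivRange.symm.surjective

theorem rank_map_le_rank_map {S : Submodule k U} {f : U →ₗ[k] M} {g : U →ₗ[k] N}
    (h : ∀ x ∈ S, f x = 0 → g x = 0) : Module.rank k (S.map g) ≤ Module.rank k (S.map f) := by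
  rw [← LinearMap.range_domRestrict, ← LinearMap.range_domRestrict]
  exact rank_range_le_of_ker_le fun x hx => h x x.2 hx

theorem rank_map_le_natCast_mul {m : ℕ} {c : Cardinal.{w}} {S : Submodule k U}
    {f : Fin m → U →ₗ[k] M} {g : U →ₗ[k] N} (h : ∀ x ∈ S, (∀ i, f i x = 0) → g x = 0)
    (hf : ∀ i, Module.rank k (S.map (f i)) ≤ c) : Module.rank k (S.map g) ≤ m * c := by
  let F := LinearMap.pi fun i => (f i).submoduleMap S
  have hker : LinearMap.ker F ≤ LinearMap.ker (g.domRestrict S) := fun x hx =>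
    h x x.2 fun i => congrArg Subtype.val (congrFun (LinearMap.mem_ker.1 hx) i)
  calc Module.rank k (S.map g)
      = Module.rank k (LinearMap.range (g.domRestrict S)) := by rw [LinearMap.range_domRestrict]
    _ ≤ Module.rank k (LinearMap.range F) := rank_range_le_of_ker_le hker
    _ ≤ Module.rank k (∀ i, S.map (f i)) := Submodule.rank_le _
    _ = Cardinal.sum fun i => Module.rank k (S.map (f i)) := rank_pi
    _ ≤ Cardinal.sum fun _ : Fin m => c := Cardinal.sum_le_sum _ _ hf
    _ = m * c := by simp

theorem rank_iSup_le_natCast_mul {m : ℕ} {c : Cardinal.{w}} {S : Fin m → Submodule k M}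
    (hS : ∀ i, Module.rank k (S i) ≤ c) : Module.rank k (⨆ i, S i : Submodule k M) ≤ m * c := by
  suffices key : ∀ s : Finset (Fin m), Module.rank k (s.sup S : Submodule k M) ≤ s.card * c by
    rw [← Finset.sup_univ_eq_iSup]
    exact (key Finset.univ).trans_eq (by rw [Finset.card_fin])
  intro s
  induction s using Finset.induction_on with
  | empty => simp
  | insert i s hi ih =>
    rw [Finset.sup_insert, Finset.card_insert_of_notMem hi, Nat.cast_succ, add_one_mul, add_comm]
    exact (Submodule.rank_add_le_rank_add_rank _ _).trans (add_le_add (hS i) ih)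

end Rank

section TensorProduct

theorem eq_zero_of_single_tmul_eq_zero {N : Type*} [AddCommGroup N] [Module k N] {i : ι} {x : N}
    (h : (Finsupp.single i 1 : ι →₀ k) ⊗ₜ[k] x = 0) : x = 0 := by
  have hx := congr(TensorProduct.lid k N ((Finsupp.lapply i).rTensor N $h))
  rwa [LinearMap.rTensor_tmul, TensorProduct.lid_tmul, Finsupp.lapply_apply,
    Finsupp.single_eq_same, one_smul, map_zero, map_zero] at hx

variable {M₁ M₂ M N₁ N₂ N : Type*} [AddCommGroup M₁] [AddCommGroup M₂] [AddCommGroup M]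
  [AddCommGroup N₁] [AddCommGroup N₂] [AddCommGroup N] [Module k M₁] [Module k M₂] [Module k M]
  [Module k N₁] [Module k N₂] [Module k N] (f : M₁ →ₗ[k] M₂ →ₗ[k] M) (g : N₁ →ₗ[k] N₂ →ₗ[k] N)
  (s : Finset ι) (t : Finset κ) (p : ι → M₁) (q : κ → M₂) (a : ι → N₁) (b : κ → N₂)

theorem map₂_sum_tmul_sum_tmul :
    TensorProduct.map₂ f g (∑ i ∈ s, p i ⊗ₜ[k] a i) (∑ j ∈ t, q j ⊗ₜ[k] b j) =
      ∑ i ∈ s, ∑ j ∈ t, f (p i) (q j) ⊗ₜ[k] g (a i) (b j) := by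
  simp only [map_sum, LinearMap.sum_apply, TensorProduct.map₂_apply_tmul, TensorProduct.map_tmul]
  exact Finset.sum_comm

theorem map₂_sum_tmul_of_left_const (c : κ → N) (h : ∀ i ∈ s, ∀ j ∈ t, g (a i) (b j) = c j) :
    TensorProduct.map₂ f g (∑ i ∈ s, p i ⊗ₜ[k] a i) (∑ j ∈ t, q j ⊗ₜ[k] b j) =
      ∑ j ∈ t, f (∑ i ∈ s, p i) (q j) ⊗ₜ[k] c j := by
  rw [map₂_sum_tmul_sum_tmul, Finset.sum_comm]
  refine Finset.sum_congr rfl fun j hj => ?_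
  rw [map_sum, LinearMap.sum_apply, TensorProduct.sum_tmul]
  exact Finset.sum_congr rfl fun i hi => by rw [h i hi j hj]

theorem map₂_sum_tmul_of_right_const (c : ι → N) (h : ∀ i ∈ s, ∀ j ∈ t, g (a i) (b j) = c i) :
    TensorProduct.map₂ f g (∑ i ∈ s, p i ⊗ₜ[k] a i) (∑ j ∈ t, q j ⊗ₜ[k] b j) =
      ∑ i ∈ s, f (p i) (∑ j ∈ t, q j) ⊗ₜ[k] c i := by
  rw [map₂_sum_tmul_sum_tmul]
  refine Finset.sum_congr rfl fun i hi => ?_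
  rw [map_sum, TensorProduct.sum_tmul]
  exact Finset.sum_congr rfl fun j hj => by rw [h i hi j hj]

end TensorProduct

end LinearAlgebra

section Growth

variable {c c' : ℕ → Cardinal.{w}}

theorem lt_aleph0_and_toNat_le_of_le_natCast_mul {a b : Cardinal.{w}} {n : ℕ} (h : a ≤ n * b)
    (hb : b < Cardinal.aleph0) : a < Cardinal.aleph0 ∧ (a.toNat : ℝ) ≤ n * b.toNat := by
  have hlt : n * b < Cardinal.aleph0 := Cardinal.mul_lt_aleph0 Cardinal.natCast_lt_aleph0 hb
  refine ⟨h.trans_lt hlt, ?_⟩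
  have := Cardinal.toNat_le_toNat h hlt
  rw [map_mul, Cardinal.toNat_natCast] at this
  exact_mod_cast this

theorem PolynomialGrowth.of_le_natCast_mul (h : ∀ n : ℕ, 1 ≤ n → c n ≤ n * c' n)
    (hc : PolynomialGrowth c') : PolynomialGrowth c := by
  obtain ⟨C, d, hC⟩ := hc
  refine ⟨C, d + 1, fun n hn => ?_⟩
  obtain ⟨hfin, hle⟩ := lt_aleph0_and_toNat_le_of_le_natCast_mul (h n hn) (hC n hn).1
  refine ⟨hfin, hle.trans ?_⟩
  calc (n : ℝ) * (c' n).toNat ≤ n * (C * n ^ d) := by gcongr; exact (hC n hn).2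
    _ = C * n ^ (d + 1) := by ring

theorem natCast_le_inv_mul_pow {b : ℝ} (hb : 1 < b) (n : ℕ) : (n : ℝ) ≤ (b - 1)⁻¹ * b ^ n := by
  have bernoulli := one_add_mul_le_pow (a := b - 1) (by linarith) n
  rw [add_sub_cancel] at bernoulli
  rw [le_inv_mul_iff₀ (by linarith)]
  linarith

theorem SubexponentialGrowth.of_le_natCast_mul (h : ∀ n : ℕ, 1 ≤ n → c n ≤ n * c' n)
    (hc : SubexponentialGrowth c') : SubexponentialGrowth c := by
  intro a ha
  have hb : 1 < √a := Real.lt_sqrt_of_sq_lt (by simpa using ha)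
  obtain ⟨C, hC⟩ := hc √a hb
  refine ⟨(√a - 1)⁻¹ * C, fun n hn => ?_⟩
  obtain ⟨hfin, hle⟩ := lt_aleph0_and_toNat_le_of_le_natCast_mul (h n hn) (hC n hn).1
  refine ⟨hfin, hle.trans ?_⟩
  have hC₀ : 0 ≤ C * √a ^ n := (Nat.cast_nonneg _).trans (hC n hn).2
  calc (n : ℝ) * (c' n).toNat ≤ n * (C * √a ^ n) := by gcongr; exact (hC n hn).2
    _ ≤ ((√a - 1)⁻¹ * √a ^ n) * (C * √a ^ n) := by gcongr; exact natCast_le_inv_mul_pow hb n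
    _ = (√a - 1)⁻¹ * C * (√a * √a) ^ n := by ring
    _ = (√a - 1)⁻¹ * C * a ^ n := by rw [Real.mul_self_sqrt (by linarith)]

end Growth

section Polynomials

variable {k : Type u} [Field k] {Ω : Type v}

theorem eqOn_multilinearPoly {M : Type*} [AddCommGroup M] [Module k M] {n : ℕ}
    {F G : OmegaPoly k Ω →ₗ[k] M}
    (h : ∀ t : OmegaWord Ω, t.vars = Multiset.range n →
      F (Finsupp.single t 1) = G (Finsupp.single t 1)) :
    Set.EqOn F G (multilinearPoly k Ω n) := by
  rw [multilinearPoly, Finsupp.supported_eq_span_single]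
  refine LinearMap.eqOn_span ?_
  rintro _ ⟨t, ht, rfl⟩
  exact h t ht

theorem identities_generatedVariety (C : Set (OmegaAlg.{u, v, w} k Ω)) :
    identities (generatedVariety C) = identities C :=
  le_antisymm (fun _ hf A hA => hf A fun _ hg => hg A hA) fun f hf _ hA => hA f hf

theorem mkQ_identities_eq_zero {V : Set (OmegaAlg.{u, v, w} k Ω)} {f : OmegaPoly k Ω} :
    (identities V).mkQ f = 0 ↔ f ∈ identities V :=
  Submodule.Quotient.mk_eq_zero _

namespace OmegaAlg

variable (A : OmegaAlg.{u, v, w} k Ω) {a b : ℕ → A.carrier} {n : ℕ} {f : OmegaPoly k Ω}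

theorem eval_single (a : ℕ → A.carrier) (t : OmegaWord Ω) :
    A.eval a (Finsupp.single t 1) = A.evalWord a t := by
  rw [eval, Finsupp.linearCombination_single, one_smul]

theorem evalWord_congr {t : OmegaWord Ω} (h : ∀ i ∈ t.vars, a i = b i) :
    A.evalWord a t = A.evalWord b t := by
  induction t with
  | var i => exact h i (Multiset.mem_singleton_self i)
  | op ω s t hs ht =>
    simp only [OmegaWord.vars, Multiset.mem_add] at h
    simp only [evalWord, hs fun i hi => h i (.inl hi), ht fun i hi => h i (.inr hi)]

theorem eval_congr (hf : f ∈ multilinearPoly k Ω n) (h : ∀ i < n, a i = b i) :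
    A.eval a f = A.eval b f :=
  eqOn_multilinearPoly (fun t ht => by
    rw [eval_single, eval_single]
    exact A.evalWord_congr fun i hi => h i (Multiset.mem_range.1 (ht ▸ hi))) hf

theorem evalWord_update_of_notMem (a : ℕ → A.carrier) {i : ℕ} (x : A.carrier) {t : OmegaWord Ω}
    (hi : i ∉ t.vars) : A.evalWord (Function.update a i x) t = A.evalWord a t :=
  A.evalWord_congr fun _ hj => Function.update_of_ne (ne_of_mem_of_not_mem hj hi) _ _

theorem isLinearMap_evalWord_update (a : ℕ → A.carrier) {i : ℕ} {t : OmegaWord Ω}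
    (ht : t.vars.Nodup) (hi : i ∈ t.vars) :
    IsLinearMap k fun x => A.evalWord (Function.update a i x) t := by
  induction t with
  | var j =>
    obtain rfl : i = j := Multiset.mem_singleton.1 hi
    simp only [evalWord, Function.update_self]
    exact LinearMap.id.isLinear
  | op ω s t ihs iht =>
    simp only [OmegaWord.vars, Multiset.nodup_add, Multiset.mem_add] at ht hi
    obtain ⟨hs, ht, hst⟩ := ht
    rcases hi with hi | hi
    · simp only [evalWord, A.evalWord_update_of_notMem a _ (Multiset.disjoint_left.1 hst hi)]
      exact ((A.op ω).flip (A.evalWord a t) ∘ₗ (ihs hs hi).mk' _).isLinear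
    · simp only [evalWord, A.evalWord_update_of_notMem a _ (Multiset.disjoint_right.1 hst hi)]
      exact (A.op ω (A.evalWord a s) ∘ₗ (iht ht hi).mk' _).isLinear

theorem isLinearMap_eval_update (a : ℕ → A.carrier) (hf : f ∈ multilinearPoly k Ω n) {i : ℕ}
    (hi : i < n) : IsLinearMap k fun x => A.eval (Function.update a i x) f := by
  have hword (t : OmegaWord Ω) (ht : t.vars = Multiset.range n) :=
    A.isLinearMap_evalWord_update a (t := t) (i := i) (ht ▸ Multiset.nodup_range n)
      (ht ▸ Multiset.mem_range.2 hi)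
  constructor
  · intro x y
    refine eqOn_multilinearPoly (G := A.eval (Function.update a i x) +
      A.eval (Function.update a i y)) (fun t ht => ?_) hf
    simpa only [LinearMap.add_apply, eval_single] using (hword t ht).map_add x y
  · intro c x
    refine eqOn_multilinearPoly (G := c • A.eval (Function.update a i x)) (fun t ht => ?_) hf
    simpa only [LinearMap.smul_apply, eval_single] using (hword t ht).map_smul c x

theorem satisfies_of_span_eq_top {S : Set A.carrier} (hS : Submodule.span k S = ⊤)
    (hf : f ∈ multilinearPoly k Ω n) (h : ∀ a, (∀ i < n, a i ∈ S) → A.eval a f = 0) :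
    A.Satisfies f := by
  suffices key : ∀ m ≤ n, ∀ a : ℕ → A.carrier, (∀ i < n, m ≤ i → a i ∈ S) → A.eval a f = 0 from
    fun a => key n le_rfl a fun i hi hni => absurd hi hni.not_gt
  intro m
  induction m with
  | zero => exact fun _ a ha => h a fun i hi => ha i hi i.zero_le
  | succ m ih =>
    intro hm a ha
    have hlin : (A.isLinearMap_eval_update a hf (i := m) hm).mk' _ = 0 := by
      refine LinearMap.ext_on hS fun x hx => ih (Nat.le_of_succ_le hm) _ fun i hi hmi => ?_
      rcases hmi.eq_or_lt with rfl | hmi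
      · rwa [Function.update_self]
      · rw [Function.update_of_ne hmi.ne']
        exact ha i hi hmi
    simpa using LinearMap.congr_fun hlin (a m)

end OmegaAlg

end Polynomials

/-- The symbol `ω` underlying `⊢_ω` and `⊣_ω`. -/
def DiOp.base {Ω : Type v} : DiOp Ω → Ω
  | .vdash ω => ω
  | .dashv ω => ω

namespace OmegaWord

variable {Ω : Type v}

/-- The word obtained from a dialgebra word by identifying `⊢_ω` and `⊣_ω` with one operation. -/
def forget : OmegaWord (DiOp Ω) → OmegaWord Ω
  | .var i => .var i
  | .op δ s t => .op δ.base s.forget t.forget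

/-- The central variable of a dialgebra word: the one reached from the root by following the
direction in which the operation symbols point. -/
def center : OmegaWord (DiOp Ω) → ℕ
  | .var i => i
  | .op (.vdash _) _ t => t.center
  | .op (.dashv _) s _ => s.center

/-- The dialgebra word obtained by making every operation whose arguments contain `xᵢ` point
at `xᵢ`. The other operations are made to be `⊣`; in `di-Alg₀` this choice does not matter. -/
def orient (i : ℕ) : OmegaWord Ω → OmegaWord (DiOp Ω)
  | .var j => .var j
  | .op ω s t => .op (if i ∈ t.vars then .vdash ω else .dashv ω) (s.orient i) (t.orient i)

theorem toFinset_vars_nonempty (t : OmegaWord Ω) : t.vars.toFinset.Nonempty := by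
  induction t with
  | var i => exact ⟨i, by simp [vars]⟩
  | op ω s t hs _ =>
    rw [vars, Multiset.toFinset_add]
    exact hs.mono Finset.subset_union_left

theorem vars_forget (p : OmegaWord (DiOp Ω)) : p.forget.vars = p.vars := by
  induction p with
  | var i => rfl
  | op δ s t hs ht => rw [forget, vars, hs, ht, vars]

theorem center_mem_vars (p : OmegaWord (DiOp Ω)) : p.center ∈ p.vars := by
  induction p with
  | var i => exact Multiset.mem_singleton_self i
  | op δ s t hs ht =>
    cases δ with
    | vdash ω => exact Multiset.mem_add.2 (.inr ht)
    | dashv ω => exact Multiset.mem_add.2 (.inl hs)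

theorem forget_orient (i : ℕ) (t : OmegaWord Ω) : (t.orient i).forget = t := by
  induction t with
  | var j => rfl
  | op ω s t hs ht =>
    rw [orient, forget, hs, ht, apply_ite DiOp.base, DiOp.base, DiOp.base, ite_self]

theorem vars_orient (i : ℕ) (t : OmegaWord Ω) : (t.orient i).vars = t.vars := by
  rw [← vars_forget, forget_orient]

theorem orient_op_of_mem_left {i : ℕ} {s t : OmegaWord Ω} (hst : Disjoint s.vars t.vars)
    (hi : i ∈ s.vars) (ω : Ω) :
    (op ω s t).orient i = .op (.dashv ω) (s.orient i) (t.orient i) := by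
  rw [orient, if_neg (Multiset.disjoint_left.1 hst hi)]

theorem orient_op_of_mem_right {i : ℕ} {t : OmegaWord Ω} (hi : i ∈ t.vars) (ω : Ω)
    (s : OmegaWord Ω) : (op ω s t).orient i = .op (.vdash ω) (s.orient i) (t.orient i) := by
  rw [orient, if_pos hi]

end OmegaWord

/-- The linear extension of `OmegaWord.orient` to polynomials. -/
noncomputable def orientPoly (k : Type u) [Field k] (Ω : Type v) (i : ℕ) :
    OmegaPoly k Ω →ₗ[k] OmegaPoly k (DiOp Ω) :=
  Finsupp.lmapDomain k k (OmegaWord.orient i)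

section DiAlgZero

variable {k : Type u} [Field k] {Ω : Type v} {D : OmegaAlg.{u, v, w} k (DiOp Ω)}

theorem orientPoly_single (i : ℕ) (t : OmegaWord Ω) :
    orientPoly k Ω i (Finsupp.single t 1) = Finsupp.single (t.orient i) 1 :=
  Finsupp.mapDomain_single

theorem orientPoly_mem_multilinearPoly {n : ℕ} (i : ℕ) {f : OmegaPoly k Ω}
    (hf : f ∈ multilinearPoly k Ω n) : orientPoly k Ω i f ∈ multilinearPoly k (DiOp Ω) n := by
  refine (Finsupp.lmapDomain_supported k k (OmegaWord.orient i) _).trans_le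
    (Finsupp.supported_mono ?_) (Submodule.mem_map_of_mem hf)
  rintro _ ⟨t, ht, rfl⟩
  exact (OmegaWord.vars_orient i t).trans ht

/-- The elements that annihilate everything in the non-central argument of an operation. For
`D ∈ di-Alg₀` they form an ideal, modulo which `⊢_ω` and `⊣_ω` coincide. -/
def noncentralAnnihilator (D : OmegaAlg.{u, v, w} k (DiOp Ω)) : Submodule k D.carrier :=
  ⨅ μ, LinearMap.ker (D.op (.vdash μ)) ⊓ LinearMap.ker (D.op (.dashv μ)).flip

theorem sModEq_noncentralAnnihilator_iff {x y : D.carrier} :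
    x ≡ y [SMOD noncentralAnnihilator D] ↔
      ∀ μ, D.op (.vdash μ) x = D.op (.vdash μ) y ∧
        ∀ z, D.op (.dashv μ) z x = D.op (.dashv μ) z y := by
  simp [SModEq.sub_mem, noncentralAnnihilator, Submodule.mem_iInf, sub_eq_zero, LinearMap.ext_iff]

theorem op_vdash_sModEq_op_dashv (hD : D ∈ diAlgZero k Ω) (ω : Ω) (x y : D.carrier) :
    D.op (.vdash ω) x y ≡ D.op (.dashv ω) x y [SMOD noncentralAnnihilator D] := by
  refine sModEq_noncentralAnnihilator_iff.2 fun μ => ⟨LinearMap.ext fun z => ?_, fun z => ?_⟩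
  · simpa [sub_eq_zero] using (hD ω μ x y z).1
  · simpa [sub_eq_zero] using (hD ω μ z x y).2

theorem op_sModEq_op (hD : D ∈ diAlgZero k Ω) {δ ε : DiOp Ω} (h : δ.base = ε.base)
    {x x' y y' : D.carrier} (hx : x ≡ x' [SMOD noncentralAnnihilator D])
    (hy : y ≡ y' [SMOD noncentralAnnihilator D]) :
    D.op δ x y ≡ D.op ε x' y' [SMOD noncentralAnnihilator D] := by
  have hdash (δ : DiOp Ω) (x y : D.carrier) :
      D.op δ x y ≡ D.op (.vdash δ.base) x y [SMOD noncentralAnnihilator D] := by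
    cases δ with
    | vdash ω => rfl
    | dashv ω => exact (op_vdash_sModEq_op_dashv hD ω x y).symm
  calc D.op δ x y
    _ ≡ D.op (.vdash δ.base) x y [SMOD noncentralAnnihilator D] := hdash δ x y
    _ = D.op (.vdash δ.base) x' y := by rw [(sModEq_noncentralAnnihilator_iff.1 hx _).1]
    _ ≡ D.op (.dashv δ.base) x' y [SMOD noncentralAnnihilator D] :=
      op_vdash_sModEq_op_dashv hD _ x' y
    _ = D.op (.dashv δ.base) x' y' := (sModEq_noncentralAnnihilator_iff.1 hy _).2 x'
    _ ≡ D.op (.vdash δ.base) x' y' [SMOD noncentralAnnihilator D] := (hdash (.dashv _) x' y')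
    _ = D.op (.vdash ε.base) x' y' := by rw [h]
    _ ≡ D.op ε x' y' [SMOD noncentralAnnihilator D] := (hdash ε x' y').symm

theorem evalWord_sModEq_of_forget_eq (hD : D ∈ diAlgZero k Ω) (a : ℕ → D.carrier)
    {p q : OmegaWord (DiOp Ω)} (h : p.forget = q.forget) :
    D.evalWord a p ≡ D.evalWord a q [SMOD noncentralAnnihilator D] := by
  induction p generalizing q with
  | var i =>
    cases q with
    | var j => rw [OmegaWord.var.inj h]
    | op ε q₁ q₂ => cases h
  | op δ p₁ p₂ ih₁ ih₂ =>
    cases q with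
    | var j => cases h
    | op ε q₁ q₂ =>
      obtain ⟨hbase, h₁, h₂⟩ := OmegaWord.op.inj h
      exact op_sModEq_op hD hbase (ih₁ h₁) (ih₂ h₂)

theorem evalWord_sModEq_evalWord_orient (hD : D ∈ diAlgZero k Ω) (a : ℕ → D.carrier)
    (i : ℕ) (p : OmegaWord (DiOp Ω)) :
    D.evalWord a p ≡ D.evalWord a (p.forget.orient i) [SMOD noncentralAnnihilator D] :=
  evalWord_sModEq_of_forget_eq hD a (OmegaWord.forget_orient i _).symm

theorem evalWord_eq_evalWord_orient_center (hD : D ∈ diAlgZero k Ω) (a : ℕ → D.carrier)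
    {p : OmegaWord (DiOp Ω)} (hp : p.vars.Nodup) :
    D.evalWord a p = D.evalWord a (p.forget.orient p.center) := by
  induction p with
  | var i => rfl
  | op δ s t ihs iht =>
    obtain ⟨hs, ht, hst⟩ := Multiset.nodup_add.1 hp
    rw [← s.vars_forget, ← t.vars_forget] at hst
    cases δ with
    | vdash ω =>
      have hc : t.center ∈ t.forget.vars := t.vars_forget ▸ t.center_mem_vars
      have hcongr := sModEq_noncentralAnnihilator_iff.1
        (evalWord_sModEq_evalWord_orient hD a t.center s) ω
      simp only [OmegaWord.forget, OmegaWord.center, DiOp.base,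
        OmegaWord.orient_op_of_mem_right hc, OmegaAlg.evalWord]
      rw [← iht ht, hcongr.1]
    | dashv ω =>
      have hc : s.center ∈ s.forget.vars := s.vars_forget ▸ s.center_mem_vars
      have hcongr := sModEq_noncentralAnnihilator_iff.1
        (evalWord_sModEq_evalWord_orient hD a s.center t) ω
      simp only [OmegaWord.forget, OmegaWord.center, DiOp.base,
        OmegaWord.orient_op_of_mem_left hst hc, OmegaAlg.evalWord]
      rw [← ihs hs, hcongr.2]

end DiAlgZero

namespace PreComAlg

variable {k : Type u} [Field k] (Z : PreComAlg.{u, w} k) {ι : Type*}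

theorem commute_mul (x y : Z.carrier) :
    Commute (Z.mul x : Module.End k Z.carrier) (Z.mul y) :=
  LinearMap.ext fun w => by
    rw [Module.End.mul_apply, Module.End.mul_apply, ← Z.preCom, ← Z.preCom, add_comm]

/-- The composition of the commuting operators of left multiplication by `z i`, `i ∈ s`. -/
def leftMul (z : ι → Z.carrier) (s : Finset ι) : Module.End k Z.carrier :=
  s.noncommProd (fun i => Z.mul (z i)) fun i _ j _ _ => Z.commute_mul (z i) (z j)

theorem leftMul_empty (z : ι → Z.carrier) : Z.leftMul z ∅ = 1 :=
  Finset.noncommProd_empty _ _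

theorem leftMul_singleton (z : ι → Z.carrier) (i : ι) : Z.leftMul z {i} = Z.mul (z i) :=
  Finset.noncommProd_singleton _ _

theorem leftMul_apply_eq_zero (z : ι → Z.carrier) {s : Finset ι} {i : ι} (hi : i ∈ s)
    {x : Z.carrier} (hx : Z.mul (z i) x = 0) : Z.leftMul z s x = 0 := by
  classical
  have herase := Finset.noncommProd_erase_mul s hi (fun j => Z.mul (z j)) fun _ _ _ _ _ =>
    Z.commute_mul _ _
  rw [leftMul, ← herase, Module.End.mul_apply, hx, map_zero]

variable [DecidableEq ι] (z : ι → Z.carrier) {s t : Finset ι} {i : ι}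

theorem leftMul_union (hst : Disjoint s t) :
    Z.leftMul z (s ∪ t) = Z.leftMul z s * Z.leftMul z t :=
  Finset.noncommProd_union_of_disjoint hst _ _

theorem leftMul_insert (hi : i ∉ s) : Z.leftMul z (insert i s) = Z.mul (z i) * Z.leftMul z s :=
  Finset.noncommProd_insert_of_notMem _ _ _ _ hi

/-- The product `z j₁ (z j₂ (⋯ (z jₘ z i)))` over the elements `j₁, …, jₘ` of `s` other than `i`. -/
def tailProd (s : Finset ι) (i : ι) : Z.carrier :=
  Z.leftMul z (s.erase i) (z i)

theorem tailProd_singleton (i : ι) : Z.tailProd z {i} i = z i := by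
  rw [tailProd, Finset.erase_singleton, leftMul_empty, Module.End.one_apply]

theorem tailProd_union_left (hst : Disjoint s t) (hi : i ∈ s) :
    Z.tailProd z (s ∪ t) i = Z.leftMul z t (Z.tailProd z s i) := by
  have herase : (s ∪ t).erase i = t ∪ s.erase i := by
    rw [Finset.erase_union_distrib, Finset.erase_eq_of_notMem (Finset.disjoint_left.1 hst hi),
      Finset.union_comm]
  rw [tailProd, herase, Z.leftMul_union z (hst.symm.mono_right (s.erase_subset i)),
    Module.End.mul_apply, tailProd]

theorem tailProd_union_right (hst : Disjoint s t) (hi : i ∈ t) :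
    Z.tailProd z (s ∪ t) i = Z.leftMul z s (Z.tailProd z t i) := by
  rw [Finset.union_comm, Z.tailProd_union_left z hst.symm hi]

-- The sum is the product of all `z i` under the commutative associative product `x y + y x`.
theorem mul_sum_tailProd (hs : s.Nonempty) :
    Z.mul (∑ i ∈ s, Z.tailProd z s i) = Z.leftMul z s := by
  induction hs using Finset.Nonempty.cons_induction with
  | singleton i => rw [Finset.sum_singleton, tailProd_singleton, leftMul_singleton]
  | cons i s hi _ ih =>
    have hdisj : Disjoint {i} s := Finset.disjoint_singleton_left.2 hi
    have htail : Z.tailProd z ({i} ∪ s) i = Z.mul (∑ j ∈ s, Z.tailProd z s j) (z i) := by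
      rw [Z.tailProd_union_left z hdisj (Finset.mem_singleton_self i), tailProd_singleton, ih]
    have hrest : ∑ j ∈ s, Z.tailProd z ({i} ∪ s) j = Z.mul (z i) (∑ j ∈ s, Z.tailProd z s j) := by
      rw [map_sum]
      refine Finset.sum_congr rfl fun j hj => ?_
      rw [Z.tailProd_union_right z hdisj hj, leftMul_singleton]
    ext x
    rw [Finset.sum_cons, Finset.cons_eq_insert, Z.leftMul_insert z hi, Finset.insert_eq, htail,
      hrest, add_comm, Z.preCom, ih, Module.End.mul_apply]

end PreComAlg

section Boxtimes

variable {k : Type u} [Field k] {Ω : Type v} (Z : PreComAlg.{u, w} k)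
  {D : OmegaAlg.{u, v, w} k (DiOp Ω)}

/-- The identification of the tensor product `Z ⊗ D` with the space of `Z ⊠ D`, which holds by
definition but is hidden behind the structure `boxtimes Z D`. -/
noncomputable def boxTensor (D : OmegaAlg.{u, v, w} k (DiOp Ω)) :
    Z.carrier ⊗[k] D.carrier ≃ₗ[k] (boxtimes Z D).carrier :=
  LinearEquiv.refl k _

theorem boxtimes_op (D : OmegaAlg.{u, v, w} k (DiOp Ω)) (ω : Ω)
    (x y : Z.carrier ⊗[k] D.carrier) :
    (boxtimes Z D).op ω (boxTensor Z D x) (boxTensor Z D y) =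
      boxTensor Z D (TensorProduct.map₂ Z.mul (D.op (.vdash ω)) x y +
        TensorProduct.map₂ Z.mul.flip (D.op (.dashv ω)) x y) := rfl

theorem evalWord_boxtimes (hD : D ∈ diAlgZero k Ω) (z : ℕ → Z.carrier) (a : ℕ → D.carrier)
    {t : OmegaWord Ω} (ht : t.vars.Nodup) :
    (boxtimes Z D).evalWord (fun i => boxTensor Z D (z i ⊗ₜ[k] a i)) t = boxTensor Z D
      (∑ i ∈ t.vars.toFinset, Z.tailProd z t.vars.toFinset i ⊗ₜ[k] D.evalWord a (t.orient i)) := by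
  induction t with
  | var i =>
    simp [OmegaWord.vars, OmegaAlg.evalWord, PreComAlg.tailProd_singleton, OmegaWord.orient]
  | op ω s t ihs iht =>
    obtain ⟨hs, ht, hst⟩ := Multiset.nodup_add.1 ht
    have hst' : Disjoint s.vars.toFinset t.vars.toFinset := Multiset.disjoint_toFinset.2 hst
    have horient (r : OmegaWord Ω) (i j : ℕ) : D.evalWord a (r.orient i) ≡
        D.evalWord a (r.orient j) [SMOD noncentralAnnihilator D] :=
      evalWord_sModEq_of_forget_eq hD a (by rw [OmegaWord.forget_orient, OmegaWord.forget_orient])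
    rw [OmegaAlg.evalWord, ihs hs, iht ht, boxtimes_op,
      map₂_sum_tmul_of_left_const (c := fun j => D.evalWord a ((OmegaWord.op ω s t).orient j)),
      map₂_sum_tmul_of_right_const (c := fun i => D.evalWord a ((OmegaWord.op ω s t).orient i)),
      OmegaWord.vars, Multiset.toFinset_add, Finset.sum_union hst', add_comm]
    · congr 2
      · refine Finset.sum_congr rfl fun i hi => ?_
        rw [LinearMap.flip_apply, Z.mul_sum_tailProd z t.toFinset_vars_nonempty,
          Z.tailProd_union_left z hst' hi]
      · refine Finset.sum_congr rfl fun j hj => ?_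
        rw [Z.mul_sum_tailProd z s.toFinset_vars_nonempty, Z.tailProd_union_right z hst' hj]
    · intro i hi j _
      rw [OmegaWord.orient_op_of_mem_left hst (Multiset.mem_toFinset.1 hi), OmegaAlg.evalWord]
      exact (sModEq_noncentralAnnihilator_iff.1 (horient t j i) ω).2 _
    · intro i _ j hj
      rw [OmegaWord.orient_op_of_mem_right (Multiset.mem_toFinset.1 hj), OmegaAlg.evalWord,
        (sModEq_noncentralAnnihilator_iff.1 (horient s i j) ω).1]

theorem eval_boxtimes (hD : D ∈ diAlgZero k Ω) (z : ℕ → Z.carrier) (a : ℕ → D.carrier) {n : ℕ}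
    {f : OmegaPoly k Ω} (hf : f ∈ multilinearPoly k Ω n) :
    (boxtimes Z D).eval (fun i => boxTensor Z D (z i ⊗ₜ[k] a i)) f =
      boxTensor Z D (∑ i ∈ Finset.range n,
        Z.tailProd z (Finset.range n) i ⊗ₜ[k] D.eval a (orientPoly k Ω i f)) := by
  let F : OmegaPoly k Ω →ₗ[k] Z.carrier ⊗[k] D.carrier := ∑ i ∈ Finset.range n,
    TensorProduct.mk k _ _ (Z.tailProd z (Finset.range n) i) ∘ₗ D.eval a ∘ₗ orientPoly k Ω i
  have heq := eqOn_multilinearPoly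
    (F := (boxtimes Z D).eval fun i => boxTensor Z D (z i ⊗ₜ[k] a i))
    (G := (boxTensor Z D).toLinearMap ∘ₗ F) (fun t ht => ?_) hf
  · simpa [F] using heq
  · rw [OmegaAlg.eval_single, evalWord_boxtimes Z hD z a (ht ▸ Multiset.nodup_range n), ht,
      Multiset.toFinset_range]
    simp [F, orientPoly_single, OmegaAlg.eval_single]

theorem satisfies_boxtimes (hD : D ∈ diAlgZero k Ω) {n : ℕ} {f : OmegaPoly k Ω}
    (hf : f ∈ multilinearPoly k Ω n) (h : ∀ i < n, D.Satisfies (orientPoly k Ω i f)) :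
    (boxtimes Z D).Satisfies f := by
  have hspan : Submodule.span k {x | ∃ z a, boxTensor Z D (z ⊗ₜ a) = x} = ⊤ :=
    TensorProduct.span_tmul_eq_top k Z.carrier D.carrier
  refine OmegaAlg.satisfies_of_span_eq_top _ hspan hf fun x hx => ?_
  choose! z a hza using hx
  rw [← (boxtimes Z D).eval_congr hf hza, eval_boxtimes Z hD z a hf, Finset.sum_eq_zero, map_zero]
  intro i hi
  rw [h i (Finset.mem_range.1 hi) a, TensorProduct.tmul_zero]

end Boxtimes

section SubsetAlgebra

variable {ι : Type w} [LinearOrder ι] {S T U : Finset ι}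

/-- The condition under which the product of the basis elements of the subset algebra indexed by
`S` and `T` is nonzero. -/
def IsSubsetMul (S T : Finset ι) : Prop :=
  S.Nonempty ∧ Disjoint S T ∧ S.max < T.max

theorem IsSubsetMul.not_symm (h : IsSubsetMul S T) : ¬ IsSubsetMul T S :=
  fun h' => h.2.2.asymm h'.2.2

theorem nonempty_of_max_lt_max (h : S.max < T.max) : T.Nonempty :=
  Finset.nonempty_iff_ne_empty.2 fun hT => h.ne_bot (Finset.max_eq_bot.2 hT)

theorem isSubsetMul_or_symm_iff :
    IsSubsetMul S T ∨ IsSubsetMul T S ↔ S.Nonempty ∧ T.Nonempty ∧ Disjoint S T := by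
  constructor
  · rintro (⟨hS, hST, hlt⟩ | ⟨hT, hTS, hlt⟩)
    · exact ⟨hS, nonempty_of_max_lt_max hlt, hST⟩
    · exact ⟨nonempty_of_max_lt_max hlt, hT, hTS.symm⟩
  · rintro ⟨hS, hT, hST⟩
    have hne : S.max ≠ T.max := by
      obtain ⟨i, hi⟩ := Finset.max_of_nonempty hS
      intro h
      exact Finset.disjoint_left.1 hST (Finset.mem_of_max hi) (Finset.mem_of_max (h ▸ hi))
    exact hne.lt_or_gt.imp (fun h => ⟨hS, hST, h⟩) fun h => ⟨hT, hST.symm, h⟩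

theorem isSubsetMul_union_left_iff :
    (IsSubsetMul S T ∨ IsSubsetMul T S) ∧ IsSubsetMul (S ∪ T) U ↔
      IsSubsetMul T U ∧ IsSubsetMul S (T ∪ U) := by
  rw [isSubsetMul_or_symm_iff]
  simp only [IsSubsetMul, Finset.max_union, Finset.disjoint_union_left, Finset.disjoint_union_right,
    Finset.union_nonempty, sup_lt_iff, lt_sup_iff]
  constructor
  · rintro ⟨⟨hS, hT, hST⟩, -, ⟨hSU, hTU⟩, hS', hT'⟩
    exact ⟨⟨hT, hTU, hT'⟩, hS, ⟨hST, hSU⟩, .inr hS'⟩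
  · rintro ⟨⟨hT, hTU, hT'⟩, hS, ⟨hST, hSU⟩, hS'⟩
    exact ⟨⟨hS, hT, hST⟩, .inl hS, ⟨hSU, hTU⟩, hS'.elim (·.trans hT') id, hT'⟩

variable (k : Type u) [Field k]

open Classical in
/-- The product of the subset algebra: `e_S e_T` is `e_{S ∪ T}` if `IsSubsetMul S T` and is `0`
otherwise. It splits the product of the algebra of polynomials without constant term in variables
of square zero according to the factor that contains the largest variable. -/
noncomputable def subsetMul (ι : Type w) [LinearOrder ι] :
    (Finset ι →₀ k) →ₗ[k] (Finset ι →₀ k) →ₗ[k] (Finset ι →₀ k) :=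
  Finsupp.lift _ k _ fun S => Finsupp.lift _ k _ fun T =>
    if IsSubsetMul S T then Finsupp.single (S ∪ T) 1 else 0

variable {k}

theorem subsetMul_single_of_isSubsetMul (h : IsSubsetMul S T) :
    subsetMul k ι (.single S 1) (.single T 1) = .single (S ∪ T) 1 := by
  simp [subsetMul, h]

theorem subsetMul_single_of_not_isSubsetMul (h : ¬ IsSubsetMul S T) :
    subsetMul k ι (.single S 1) (.single T 1) = 0 := by
  simp [subsetMul, h]

theorem subsetMul_single_symm_sum (h : IsSubsetMul S T ∨ IsSubsetMul T S) :
    subsetMul k ι (.single S 1) (.single T 1) + subsetMul k ι (.single T 1) (.single S 1) =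
      .single (S ∪ T) 1 := by
  rcases h with h | h
  · rw [subsetMul_single_of_isSubsetMul h, subsetMul_single_of_not_isSubsetMul h.not_symm, add_zero]
  · rw [subsetMul_single_of_isSubsetMul h, subsetMul_single_of_not_isSubsetMul h.not_symm, zero_add,
      Finset.union_comm]

theorem subsetMul_preCom_single (S T U : Finset ι) :
    subsetMul k ι (subsetMul k ι (.single S 1) (.single T 1) +
        subsetMul k ι (.single T 1) (.single S 1)) (.single U 1) =
      subsetMul k ι (.single S 1) (subsetMul k ι (.single T 1) (.single U 1)) := by
  by_cases h : IsSubsetMul T U ∧ IsSubsetMul S (T ∪ U)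
  · obtain ⟨hST, hU⟩ := isSubsetMul_union_left_iff.2 h
    rw [subsetMul_single_symm_sum hST, subsetMul_single_of_isSubsetMul hU,
      subsetMul_single_of_isSubsetMul h.1, subsetMul_single_of_isSubsetMul h.2,
      Finset.union_assoc]
  · trans (0 : Finset ι →₀ k)
    · rw [← isSubsetMul_union_left_iff, not_and_or] at h
      rcases em (IsSubsetMul S T ∨ IsSubsetMul T S) with hST | hST
      · rw [subsetMul_single_symm_sum hST,
          subsetMul_single_of_not_isSubsetMul (h.resolve_left (not_not.2 hST))]
      · obtain ⟨hST, hTS⟩ := not_or.1 hST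
        rw [subsetMul_single_of_not_isSubsetMul hST, subsetMul_single_of_not_isSubsetMul hTS,
          add_zero, map_zero, LinearMap.zero_apply]
    · by_cases hTU : IsSubsetMul T U
      · rw [subsetMul_single_of_isSubsetMul hTU,
          subsetMul_single_of_not_isSubsetMul fun hS => h ⟨hTU, hS⟩]
      · rw [subsetMul_single_of_not_isSubsetMul hTU, map_zero]

theorem subsetMul_preCom (x y z : Finset ι →₀ k) :
    subsetMul k ι (subsetMul k ι x y + subsetMul k ι y x) z =
      subsetMul k ι x (subsetMul k ι y z) := by
  let m := subsetMul k ι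
  have h : (m.compr₂ m + m.flip.compr₂ m) =
      (LinearMap.llcomp k (Finset ι →₀ k) (Finset ι →₀ k) (Finset ι →₀ k)).compl₁₂ m m := by
    ext S T U : 6
    simpa [m] using subsetMul_preCom_single (k := k) S T U
  simpa [m] using congr($h x y z)

variable (k)

/-- The subset algebra: the pre-commutative algebra with basis `e_S`, `S` a finite subset of `ι`,
and the product `subsetMul`. -/
noncomputable abbrev subsetPreCom (ι : Type w) [LinearOrder ι] : PreComAlg.{u, max u w} k where
  carrier := Finset ι →₀ k
  mul := subsetMul k ι
  preCom := subsetMul_preCom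

variable {k} {c : ℕ → ι} {s : Finset ℕ} {i : ℕ}

theorem leftMul_single (hc : Function.Injective c) (hdisj : ∀ j ∈ s, c j ∉ T)
    (hmax : ∀ j ∈ s, (c j : WithBot ι) < T.max) :
    (subsetPreCom k ι).leftMul (fun j => .single {c j} 1) s (.single T 1) =
      .single (s.image c ∪ T) 1 := by
  induction s using Finset.induction_on with
  | empty =>
    rw [PreComAlg.leftMul_empty, Module.End.one_apply, Finset.image_empty, Finset.empty_union]
  | insert j s hj ih =>
    have hmul : IsSubsetMul {c j} (s.image c ∪ T) := by
      refine ⟨Finset.singleton_nonempty _, Finset.disjoint_singleton_left.2 ?_, ?_⟩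
      · simp [hc.eq_iff, hj, hdisj]
      · rw [Finset.max_singleton, Finset.max_union]
        exact lt_sup_of_lt_right (hmax j (Finset.mem_insert_self j s))
    rw [PreComAlg.leftMul_insert _ _ hj, Module.End.mul_apply,
      ih (fun l hl => hdisj l (Finset.mem_insert_of_mem hl))
        fun l hl => hmax l (Finset.mem_insert_of_mem hl)]
    rw [subsetMul_single_of_isSubsetMul hmul, Finset.image_insert, Finset.insert_eq,
      Finset.union_assoc]

theorem tailProd_single_of_forall_lt (hc : Function.Injective c) (hi : i ∈ s)
    (h : ∀ j ∈ s, j ≠ i → c j < c i) :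
    (subsetPreCom k ι).tailProd (fun j => .single {c j} 1) s i = .single (s.image c) 1 := by
  rw [PreComAlg.tailProd, leftMul_single hc]
  · rw [← Finset.image_singleton, ← Finset.image_union, Finset.union_comm, ← Finset.insert_eq,
      Finset.insert_erase hi]
  · intro j hj
    rw [Finset.mem_singleton, hc.eq_iff]
    exact Finset.ne_of_mem_erase hj
  · intro j hj
    rw [Finset.max_singleton, WithBot.coe_lt_coe]
    exact h j (Finset.mem_of_mem_erase hj) (Finset.ne_of_mem_erase hj)

theorem tailProd_single_of_exists_lt (h : ∃ j ∈ s, c i < c j) :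
    (subsetPreCom k ι).tailProd (fun j => .single {c j} 1) s i = 0 := by
  obtain ⟨j, hj, hij⟩ := h
  have hji : j ≠ i := by
    rintro rfl
    exact hij.false
  refine PreComAlg.leftMul_apply_eq_zero _ _ (Finset.mem_erase.2 ⟨hji, hj⟩) ?_
  refine subsetMul_single_of_not_isSubsetMul fun hmul => hij.asymm ?_
  simpa using hmul.2.2

end SubsetAlgebra

section Varieties

variable {k : Type u} [Field k] {Ω : Type v}

theorem satisfies_orientPoly {D : OmegaAlg.{u, v, max u w} k (DiOp Ω)} (hD : D ∈ diAlgZero k Ω)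
    {n i : ℕ} (hi : i < n) {f : OmegaPoly k Ω} (hf : f ∈ multilinearPoly k Ω n)
    (h : ∀ Z : PreComAlg.{u, max u w} k, (boxtimes Z D).Satisfies f) :
    D.Satisfies (orientPoly k Ω i f) := by
  intro a
  -- Exchanging `i` and `n` makes `c i` the largest index, so only the summand at `i` survives.
  let c (j : ℕ) : ULift.{w} ℕ := ⟨Equiv.swap i n j⟩
  have hc : Function.Injective c := ULift.up_injective.comp (Equiv.swap i n).injective
  have hmax (j : ℕ) (hj : j ∈ Finset.range n) (hji : j ≠ i) : c j < c i := by
    rw [Finset.mem_range] at hj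
    simpa [c, Equiv.swap_apply_of_ne_of_ne hji hj.ne] using hj
  have hmem := Finset.mem_range.2 hi
  let Z := subsetPreCom k (ULift.{w} ℕ)
  have heval := h Z fun j => boxTensor Z D (Finsupp.single {c j} 1 ⊗ₜ a j)
  rw [eval_boxtimes Z hD _ a hf, LinearEquiv.map_eq_zero_iff, Finset.sum_eq_single_of_mem i hmem,
    tailProd_single_of_forall_lt hc hmem hmax] at heval
  · exact eq_zero_of_single_tmul_eq_zero heval
  · intro j hj hji
    rw [tailProd_single_of_exists_lt ⟨i, hmem, hmax j hj hji⟩, TensorProduct.zero_tmul]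

theorem mem_identities_envelopingVariety {V : Set (OmegaAlg.{u, v, max u w} k (DiOp Ω))}
    (hV : V ⊆ diAlgZero k Ω) {n : ℕ} {f : OmegaPoly k Ω} (hf : f ∈ multilinearPoly k Ω n) :
    f ∈ identities (envelopingVariety V) ↔ ∀ i < n, orientPoly k Ω i f ∈ identities V := by
  rw [envelopingVariety, identities_generatedVariety]
  constructor
  · exact fun h i hi D hD => satisfies_orientPoly (hV hD) hi hf fun Z => h _ ⟨Z, D, hD, rfl⟩
  · rintro h _ ⟨Z, D, hD, rfl⟩
    exact satisfies_boxtimes Z (hV hD) hf fun i hi => h i hi D hD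

section OrientMk

variable {V : Set (OmegaAlg.{u, v, w} k (DiOp Ω))}

/-- The class in the free dialgebra of `V` of a polynomial oriented at `xᵢ`. On multilinear
polynomials this is the component at `xᵢ` of the passage from the enveloping variety to `V`. -/
noncomputable def orientMk (V : Set (OmegaAlg.{u, v, w} k (DiOp Ω))) (i : ℕ) :
    OmegaPoly k Ω →ₗ[k] RelFree V :=
  (identities V).mkQ ∘ₗ orientPoly k Ω i

theorem mkQ_single_eq_orientMk (hV : V ⊆ diAlgZero k Ω) {p : OmegaWord (DiOp Ω)}
    (hp : p.vars.Nodup) :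
    (identities V).mkQ (.single p 1) = orientMk V p.center (.single p.forget 1) := by
  rw [orientMk, LinearMap.comp_apply, orientPoly_single, ← sub_eq_zero, ← map_sub,
    mkQ_identities_eq_zero]
  intro D hD a
  rw [map_sub, D.eval_single, D.eval_single, evalWord_eq_evalWord_orient_center (hV hD) a hp,
    sub_self]

theorem multilinearPart_eq_iSup (hV : V ⊆ diAlgZero k Ω) (n : ℕ) :
    multilinearPart V n = ⨆ i : Fin n, (multilinearPoly k Ω n).map (orientMk V i) := by
  apply le_antisymm
  · rw [multilinearPart, multilinearPoly, Finsupp.supported_eq_span_single, Submodule.map_span_le]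
    rintro _ ⟨p, hp : p.vars = Multiset.range n, rfl⟩
    have hcenter : p.center < n := Multiset.mem_range.1 (hp ▸ p.center_mem_vars)
    rw [mkQ_single_eq_orientMk hV (hp ▸ Multiset.nodup_range n)]
    exact Submodule.mem_iSup_of_mem ⟨p.center, hcenter⟩ <| Submodule.mem_map_of_mem <|
      Finsupp.single_mem_supported k 1 (p.vars_forget.trans hp)
  · refine iSup_le fun i => ?_
    rw [orientMk, Submodule.map_comp]
    exact Submodule.map_mono (Submodule.map_le_iff_le_comap.2 fun f hf =>
      orientPoly_mem_multilinearPoly i hf)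

end OrientMk

variable {V : Set (OmegaAlg.{u, v, max u w} k (DiOp Ω))}

theorem mkQ_envelopingVariety_eq_zero_iff (hV : V ⊆ diAlgZero k Ω) {n : ℕ} {f : OmegaPoly k Ω}
    (hf : f ∈ multilinearPoly k Ω n) :
    (identities (envelopingVariety V)).mkQ f = 0 ↔ ∀ i : Fin n, orientMk V i f = 0 := by
  simp only [mkQ_identities_eq_zero, mem_identities_envelopingVariety hV hf, Fin.forall_iff,
    orientMk, LinearMap.comp_apply]

theorem codim_le_natCast_mul_codim_envelopingVariety (hV : V ⊆ diAlgZero k Ω) (n : ℕ) :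
    codim V n ≤ n * codim (envelopingVariety V) n := by
  rw [codim, multilinearPart_eq_iSup hV]
  exact rank_iSup_le_natCast_mul fun i => rank_map_le_rank_map fun f hf hzero =>
    (mkQ_envelopingVariety_eq_zero_iff hV hf).1 hzero i

theorem codim_envelopingVariety_le_natCast_mul_codim (hV : V ⊆ diAlgZero k Ω) (n : ℕ) :
    codim (envelopingVariety V) n ≤ n * codim V n := by
  refine rank_map_le_natCast_mul (f := fun i : Fin n => orientMk V i)
    (fun f hf => (mkQ_envelopingVariety_eq_zero_iff hV hf).2) fun i => Submodule.rank_mono ?_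
  rw [multilinearPart_eq_iSup hV]
  exact le_iSup (fun i : Fin n => (multilinearPoly k Ω n).map (orientMk V i)) i

end Varieties

theorem theorem4_general (k : Type u) [Field k] (Ω : Type v)
    (V : Set (OmegaAlg.{u, v, max u w} k (DiOp Ω))) (hV : V ⊆ diAlgZero k Ω) :
    (∀ n : ℕ, codim V n ≤ (n : Cardinal) * codim (envelopingVariety V) n) ∧
    (∀ n : ℕ, codim (envelopingVariety V) n ≤ (n : Cardinal) * codim V n) ∧
    (PolynomialGrowth (codim V) ↔ PolynomialGrowth (codim (envelopingVariety V))) ∧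
    (IntermediateGrowth (codim V) ↔ IntermediateGrowth (codim (envelopingVariety V))) := by
  have h₁ := codim_le_natCast_mul_codim_envelopingVariety hV
  have h₂ := codim_envelopingVariety_le_natCast_mul_codim hV
  have hpoly : PolynomialGrowth (codim V) ↔ PolynomialGrowth (codim (envelopingVariety V)) :=
    ⟨.of_le_natCast_mul fun n _ => h₂ n, .of_le_natCast_mul fun n _ => h₁ n⟩
  have hsubexp :
      SubexponentialGrowth (codim V) ↔ SubexponentialGrowth (codim (envelopingVariety V)) :=
    ⟨.of_le_natCast_mul fun n _ => h₂ n, .of_le_natCast_mul fun n _ => h₁ n⟩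
  exact ⟨h₁, h₂, hpoly, hsubexp.and hpoly.not⟩

theorem theorem4 (k : Type u) [Field k] [CharZero k] (Ω : Type v)
    (V : Set (OmegaAlg.{u, v, max u v} k (DiOp Ω))) (hV : IsVariety V)
    (hV₀ : V ⊆ diAlgZero k Ω) :
    (∀ n : ℕ, 1 ≤ n → codim V n ≤ (n : Cardinal) * codim (envelopingVariety V) n) ∧
    (∀ n : ℕ, 1 ≤ n → codim (envelopingVariety V) n ≤ (n : Cardinal) * codim V n) ∧
    (PolynomialGrowth (codim V) ↔ PolynomialGrowth (codim (envelopingVariety V))) ∧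
    (IntermediateGrowth (codim V) ↔ IntermediateGrowth (codim (envelopingVariety V))) := by
  obtain ⟨h₁, h₂, hgrowth⟩ := theorem4_general.{u, v, v} k Ω V hV₀
  exact ⟨fun n _ => h₁ n, fun n _ => h₂ n, hgrowth⟩
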